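/- Let $L$ be a finite-dimensional Lie algebra over a field $\mathbb F$ (of arbitrary characteristic), let $M$ be an abelian ideal of $L$ with centralizer $C_L(M)$, and let $x\in L$ be such that $L=C_L(M)\rtimes\langle x\rangle$, i.e. $L=C_L(M)\oplus\mathbb F x$ as vector spaces. Let $U(L)$ be the universal enveloping algebra of $L$, let $\omega(L)$ be its augmentation ideal (the kernel of the algebra homomorphism $U(L)\to\mathbb F$ sending every element of $L$ to $0$), and let $MU(L)$ and $M\omega(L)$ be the spans of the products $mu$ with $m\in M$ and with $u\in U(L)$, respectively $u\in\omega(L)$; these are two-sided ideals of $U(L)$. Let $\widetilde I=MU(L)/M\omega(L)$, considered as an abelian Lie algebra. The formula $\beta(w)(a+M\omega(L))=(wa-aw)+M\omega(L)$ ($w\in U(L)$, $a\in MU(L)$) defines a homomorphism of Lie algebras $\beta: U(L)\to\mathfrak{gl}(\widetilde I)$ that vanishes on $MU(L)$. Let $J=\ker\beta$, let $\widetilde K=U(L)/J$, considered as a Lie algebra, and let $\widetilde L_M=\widetilde I\rtimes\widetilde K$ be the semidirect sum with respect to the action of $\widetilde K$ on $\widetilde I$ induced by $\beta$. Let $M\rtimes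 L/C_L(M)$ be the semidirect sum with respect to the action of $L/C_L(M)$ on $M$ induced by the adjoint action of $L$ on $M$. Then there is an isomorphism of Lie algebras $\widetilde L_M\cong M\rtimes L/C_L(M)$ if and only if $(\operatorname{ad}x|_M)^2=\lambda\,\operatorname{ad}x|_M$ for some $\lambda\in\mathbb F$. -/

import Mathlib

noncomputable section

namespace LieTilde

open UniversalEnvelopingAlgebra

attribute [local instance 100] LieRing.ofAssociativeRing

variable (F : Type*) {L : Type*} [Field F] [LieRing L] [LieAlgebra F L]

section Augmentation

variable (L)

/-- The augmentation map `ε : U(L) → F`, the algebra homomorphism sending every `x ∈ L` to `0`. -/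
def augmentation : UniversalEnvelopingAlgebra F L →ₐ[F] F :=
  lift F (0 : L →ₗ⁅F⁆ F)

/-- The augmentation ideal `ω(L)`, the kernel of the augmentation map (as a subspace). -/
def omega : Submodule F (UniversalEnvelopingAlgebra F L) :=
  LinearMap.ker (augmentation F L).toLinearMap

end Augmentation

variable {F}

/-- The image of the ideal `M` in `U(L)`. -/
def imU (M : LieIdeal F L) : Submodule F (UniversalEnvelopingAlgebra F L) :=
  M.toSubmodule.map (ι F : L →ₗ⁅F⁆ UniversalEnvelopingAlgebra F L).toLinearMap

/-- `M U(L)`: the span of all products `m * u` with `m ∈ M` and `u ∈ U(L)`. -/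
def MU (M : LieIdeal F L) : Submodule F (UniversalEnvelopingAlgebra F L) :=
  imU M * ⊤

/-- `M ω(L)`: the span of all products `m * u` with `m ∈ M` and `u ∈ ω(L)`. -/
def MOmega (M : LieIdeal F L) : Submodule F (UniversalEnvelopingAlgebra F L) :=
  imU M * omega F L

theorem U_induction {P : UniversalEnvelopingAlgebra F L → Prop}
    (hs : ∀ c : F, P (algebraMap F _ c)) (hι : ∀ x : L, P (ι F x))
    (hm : ∀ a b, P a → P b → P (a * b)) (ha : ∀ a b, P a → P b → P (a + b))
    (a : UniversalEnvelopingAlgebra F L) : P a := by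
  let S : Subalgebra F (UniversalEnvelopingAlgebra F L) :=
    { carrier := {a | P a}
      mul_mem' := fun h h' => hm _ _ h h'
      add_mem' := fun h h' => ha _ _ h h'
      algebraMap_mem' := hs }
  let f : L →ₗ⁅F⁆ S :=
    { toFun := fun x => ⟨ι F x, hι x⟩
      map_add' := fun x y => Subtype.ext (by simp)
      map_smul' := fun c x => Subtype.ext (by simp)
      map_lie' := fun {x y} => Subtype.ext (LieHom.map_lie (ι F) x y) }
  have h : S.val.comp (lift F f) = AlgHom.id F _ := by
    apply hom_ext
    ext x
    change ((lift F f (ι F x) : S) : UniversalEnvelopingAlgebra F L) = ι F x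
    rw [lift_ι_apply]
    rfl
  have h2 : ((lift F f a : S) : UniversalEnvelopingAlgebra F L) = a := DFunLike.congr_fun h a
  rw [← h2]
  exact (lift F f a).2

theorem mem_omega (a : UniversalEnvelopingAlgebra F L) :
    a ∈ omega F L ↔ augmentation F L a = 0 := Iff.rfl

theorem ι_mem_omega (x : L) : ι F x ∈ omega F L := by
  rw [mem_omega, augmentation, lift_ι_apply]; rfl

theorem omega_mul_mem_right {a : UniversalEnvelopingAlgebra F L} (w : UniversalEnvelopingAlgebra F L)
    (ha : a ∈ omega F L) : a * w ∈ omega F L := by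
  rw [mem_omega] at *; rw [map_mul, ha, zero_mul]

theorem omega_mul_mem_left {a : UniversalEnvelopingAlgebra F L} (w : UniversalEnvelopingAlgebra F L)
    (ha : a ∈ omega F L) : w * a ∈ omega F L := by
  rw [mem_omega] at *; rw [map_mul, ha, mul_zero]

/-- A subspace `M N`, with `N` a left ideal of `U(L)`, is a left ideal of `U(L)`. -/
theorem mul_mem_left_aux (M : LieIdeal F L) (N : Submodule F (UniversalEnvelopingAlgebra F L))
    (hN : ∀ w, ∀ a ∈ N, w * a ∈ N) (w : UniversalEnvelopingAlgebra F L) :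
    ∀ a ∈ imU M * N, w * a ∈ imU M * N := by
  induction w using U_induction with
  | hs c =>
    intro a ha
    rw [← Algebra.smul_def]
    exact Submodule.smul_mem _ c ha
  | hι x =>
    intro a ha
    induction ha using Submodule.mul_induction_on' with
    | mem_mul_mem m hm u hu =>
      obtain ⟨y, hy, rfl⟩ := hm
      have h : ι F x * (ι F y * u) = ι F ⁅x, y⁆ * u + ι F y * (ι F x * u) := by
        rw [LieHom.map_lie, LieRing.of_associative_ring_bracket]
        noncomm_ring
      change ι F x * (ι F y * u) ∈ _
      rw [h]
      refine Submodule.add_mem _ (Submodule.mul_mem_mul ⟨_, ?_, rfl⟩ hu)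
        (Submodule.mul_mem_mul ⟨y, hy, rfl⟩ (hN _ _ hu))
      exact lie_mem_right F L M x y hy
    | add a _ b _ ha hb =>
      rw [mul_add]
      exact Submodule.add_mem _ ha hb
  | hm a b iha ihb =>
    intro c hc
    rw [mul_assoc]
    exact iha _ (ihb _ hc)
  | ha a b iha ihb =>
    intro c hc
    rw [add_mul]
    exact Submodule.add_mem _ (iha _ hc) (ihb _ hc)

theorem mul_mem_right_aux (M : LieIdeal F L) (N : Submodule F (UniversalEnvelopingAlgebra F L))
    (hN : ∀ w, ∀ a ∈ N, a * w ∈ N) (w : UniversalEnvelopingAlgebra F L) :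
    ∀ a ∈ imU M * N, a * w ∈ imU M * N := by
  intro a ha
  induction ha using Submodule.mul_induction_on' with
  | mem_mul_mem m hm u hu =>
    rw [mul_assoc]
    exact Submodule.mul_mem_mul hm (hN _ _ hu)
  | add a _ b _ ha hb =>
    rw [add_mul]
    exact Submodule.add_mem _ ha hb

/-- `[w, a] = w a - a w` lies in `M U(L)` for `a ∈ M U(L)`. -/
theorem lie_mem_MU (M : LieIdeal F L) (w a : UniversalEnvelopingAlgebra F L) (ha : a ∈ MU M) :
    ⁅w, a⁆ ∈ MU M :=
  Submodule.sub_mem _ (mul_mem_left_aux M ⊤ (fun _ _ _ => trivial) w a ha)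
    (mul_mem_right_aux M ⊤ (fun _ _ _ => trivial) w a ha)

/-- `[w, a] = w a - a w` lies in `M ω(L)` for `a ∈ M ω(L)`. -/
theorem lie_mem_MOmega (M : LieIdeal F L) (w a : UniversalEnvelopingAlgebra F L)
    (ha : a ∈ MOmega M) : ⁅w, a⁆ ∈ MOmega M :=
  Submodule.sub_mem _ (mul_mem_left_aux M _ (fun w _ h => omega_mul_mem_left w h) w a ha)
    (mul_mem_right_aux M _ (fun w _ h => omega_mul_mem_right w h) w a ha)

/-- The space `Ĩ = M U(L) / M ω(L)`. -/
def ITilde (M : LieIdeal F L) : Type _ :=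
  (MU M) ⧸ ((MOmega M).submoduleOf (MU M))

instance (M : LieIdeal F L) : AddCommGroup (ITilde M) :=
  inferInstanceAs (AddCommGroup ((MU M) ⧸ ((MOmega M).submoduleOf (MU M))))

instance (M : LieIdeal F L) : Module F (ITilde M) :=
  inferInstanceAs (Module F ((MU M) ⧸ ((MOmega M).submoduleOf (MU M))))

/-- `Ĩ` is considered as an abelian Lie algebra. -/
instance (M : LieIdeal F L) : LieRing (ITilde M) where
  bracket _ _ := 0
  add_lie _ _ _ := (add_zero 0).symm
  lie_add _ _ _ := (add_zero 0).symm
  lie_self _ := rfl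
  leibniz_lie _ _ _ := (add_zero 0).symm

instance (M : LieIdeal F L) : LieAlgebra F (ITilde M) where
  lie_smul c _ _ := (smul_zero c).symm

instance (M : LieIdeal F L) : IsLieAbelian (ITilde M) := ⟨fun _ _ => rfl⟩

/-- The class `a + M ω(L)` in `Ĩ` of an element `a` of `M U(L)`. -/
def ITilde.mk (M : LieIdeal F L) : MU M →ₗ[F] ITilde M :=
  Submodule.mkQ ((MOmega M).submoduleOf (MU M))

/-- For `w ∈ U(L)`, the map `a ↦ [w, a]` on `M U(L)`. -/
def adMU (M : LieIdeal F L) (w : UniversalEnvelopingAlgebra F L) : MU M →ₗ[F] MU M :=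
  ((LieAlgebra.ad F (UniversalEnvelopingAlgebra F L) w : Module.End F _)).restrict
    (fun a ha => lie_mem_MU M w a ha)

/-- The map `a + M ω(L) ↦ [w, a] + M ω(L)` on `Ĩ`. -/
def betaFun (M : LieIdeal F L) (w : UniversalEnvelopingAlgebra F L) : Module.End F (ITilde M) :=
  Submodule.mapQ _ _ (adMU M w) (fun a ha => lie_mem_MOmega M w a ha)

theorem betaFun_mk (M : LieIdeal F L) (w : UniversalEnvelopingAlgebra F L) (a : MU M) :
    betaFun M w (ITilde.mk M a) = ITilde.mk M ⟨⁅w, (a : UniversalEnvelopingAlgebra F L)⁆,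
      lie_mem_MU M w a a.2⟩ := rfl

theorem ITilde.end_ext {M : LieIdeal F L} {f g : Module.End F (ITilde M)}
    (h : ∀ a, f (ITilde.mk M a) = g (ITilde.mk M a)) : f = g :=
  Submodule.linearMap_qext _ (LinearMap.ext h)

/-- The homomorphism `β : U(L) → gl(Ĩ)`, `β(w)(a + M ω(L)) = [w, a] + M ω(L)`. It vanishes on
`M U(L)` (see `MU_le_ker_beta`), so it is the same thing as a homomorphism on `U(L) / M U(L)`. -/
def beta (M : LieIdeal F L) : UniversalEnvelopingAlgebra F L →ₗ⁅F⁆ Module.End F (ITilde M) where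
  toFun := betaFun M
  map_add' w v := ITilde.end_ext fun a => by
    rw [LinearMap.add_apply, betaFun_mk, betaFun_mk, betaFun_mk, ← map_add]
    exact congrArg _ (Subtype.ext (add_lie _ _ _))
  map_smul' c w := ITilde.end_ext fun a => by
    rw [RingHom.id_apply, LinearMap.smul_apply, betaFun_mk, betaFun_mk, ← map_smul]
    exact congrArg _ (Subtype.ext (smul_lie _ _ _))
  map_lie' {w v} := ITilde.end_ext fun a => by
    rw [LieRing.of_associative_ring_bracket (betaFun M w), LinearMap.sub_apply,
      Module.End.mul_apply, Module.End.mul_apply, betaFun_mk, betaFun_mk, betaFun_mk,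
      betaFun_mk, betaFun_mk, ← map_sub]
    exact congrArg _ (Subtype.ext (lie_lie _ _ _))

theorem beta_mk (M : LieIdeal F L) (w : UniversalEnvelopingAlgebra F L) (a : MU M) :
    beta M w (ITilde.mk M a) = ITilde.mk M ⟨⁅w, (a : UniversalEnvelopingAlgebra F L)⁆,
      lie_mem_MU M w a a.2⟩ := rfl

/-- The Lie ideal `J` of `U(L)`, the kernel of `β`. -/
def J (M : LieIdeal F L) : LieIdeal F (UniversalEnvelopingAlgebra F L) := (beta M).ker

theorem MU_le_omega (M : LieIdeal F L) : MU M ≤ omega F L := by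
  rw [MU, Submodule.mul_le]
  rintro _ ⟨y, _, rfl⟩ u _
  exact omega_mul_mem_right u (ι_mem_omega y)

theorem MU_mul_MU_le (M : LieIdeal F L) : MU M * MU M ≤ MOmega M := by
  conv_lhs => rw [MU, mul_assoc]
  refine mul_le_mul_right (Submodule.mul_le.2 ?_) _
  intro w _ a ha
  exact omega_mul_mem_left w (MU_le_omega M ha)

theorem MU_le_ker_beta (M : LieIdeal F L) : MU M ≤ (J M).toSubmodule := by
  intro w hw
  change w ∈ (beta M).ker
  rw [LieHom.mem_ker]
  refine ITilde.end_ext fun a => ?_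
  rw [beta_mk, LinearMap.zero_apply]
  refine (Submodule.Quotient.mk_eq_zero _).2 ?_
  exact Submodule.sub_mem _ (MU_mul_MU_le M (Submodule.mul_mem_mul hw a.2))
    (MU_mul_MU_le M (Submodule.mul_mem_mul a.2 hw))

/-- The Lie algebra homomorphism `A / I → B` induced by `f : A → B` with `I ≤ ker f`. -/
def quotLift {A B : Type*} [LieRing A] [LieAlgebra F A] [LieRing B] [LieAlgebra F B]
    (I : LieIdeal F A) (f : A →ₗ⁅F⁆ B) (h : ∀ a ∈ I, f a = 0) : (A ⧸ I) →ₗ⁅F⁆ B where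
  toLinearMap := I.toSubmodule.liftQ f.toLinearMap (fun a ha => h a ha)
  map_lie' {a b} := by
    induction a using Submodule.Quotient.induction_on
    induction b using Submodule.Quotient.induction_on
    exact f.map_lie _ _

/-- The Lie algebra `K̃ = U(L) / J`. -/
abbrev KTilde (M : LieIdeal F L) : Type _ := UniversalEnvelopingAlgebra F L ⧸ J M

/-- `gl(V)` is the Lie algebra of derivations of an abelian Lie algebra `V`. -/
def endToDer (V : Type*) [LieRing V] [LieAlgebra F V] [IsLieAbelian V] :
    Module.End F V →ₗ⁅F⁆ LieDerivation F V V where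
  toFun f := { toLinearMap := f, leibniz' := fun a b => by simp [trivial_lie_zero] }
  map_add' _ _ := rfl
  map_smul' _ _ := rfl
  map_lie' {f g} := by
    ext a
    rw [LieDerivation.commutator_apply]
    rfl

/-- The action of `K̃` on `Ĩ` induced by `β`. -/
def betaTilde (M : LieIdeal F L) : KTilde M →ₗ⁅F⁆ LieDerivation F (ITilde M) (ITilde M) :=
  (endToDer (ITilde M)).comp (quotLift (J M) (beta M) (fun _ ha => LieHom.mem_ker.1 ha))

/-- The Lie algebra `L̃_M = Ĩ ⋊ K̃`. -/
abbrev LTilde (M : LieIdeal F L) : Type _ :=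
  LieAlgebra.SemiDirectSum (ITilde M) (KTilde M) (betaTilde M)

/-- The centralizer `C_L(M)` of an ideal `M` of `L`. -/
def centralizer (M : LieIdeal F L) : LieIdeal F L where
  carrier := {y | ∀ m ∈ M, ⁅y, m⁆ = 0}
  add_mem' ha hb m hm := by rw [add_lie, ha m hm, hb m hm, add_zero]
  zero_mem' m _ := zero_lie m
  smul_mem' c y hy m hm := by rw [smul_lie, hy m hm, smul_zero]
  lie_mem {z y} hy m hm := by
    rw [lie_lie, hy m hm, hy _ (lie_mem_right F L M z m hm), lie_zero, sub_zero]

/-- The restriction to the ideal `M` of the adjoint action of `L`, by derivations of `M`. -/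
def adDer (M : LieIdeal F L) : L →ₗ⁅F⁆ LieDerivation F M M where
  toFun y :=
    { toLinearMap := LieModule.toEnd F L M y
      leibniz' := fun a b => by
        apply Subtype.ext
        change ⁅y, ⁅(a : L), (b : L)⁆⁆ = ⁅(a : L), ⁅y, (b : L)⁆⁆ - ⁅(b : L), ⁅y, (a : L)⁆⁆
        rw [leibniz_lie, ← lie_skew (b : L)]
        abel }
  map_add' y z := by ext a; exact congrArg Subtype.val (add_lie y z a)
  map_smul' c y := by ext a; exact congrArg Subtype.val (smul_lie c y a)
  map_lie' {y z} := by
    ext a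
    rw [LieDerivation.commutator_apply]
    exact congrArg Subtype.val (lie_lie y z a)

/-- The action of `L / C_L(M)` on `M` induced by the adjoint action, `(y + C_L(M)) m = [y, m]`. -/
def adQuot (M : LieIdeal F L) : (L ⧸ centralizer M) →ₗ⁅F⁆ LieDerivation F M M :=
  quotLift (centralizer M) (adDer M) (fun y hy => by
    ext a
    exact hy a a.2)

end LieTilde

end

/-! Write `D` for the operator `ad x` on `M` and `ε` for the augmentation. Modulo `M ω(L)` one has
`m u ≡ ε(u) m`, and also `u m ≡ ρ(u) m`, where `ρ` extends the adjoint representation to `U(L)`; the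
latter starts from `y m = [y, m] + m y` with `m y ∈ M ω(L)`. Hence `M` maps onto `Ĩ`, and on the
image `β(u)` becomes `ρ(u) - ε(u)`, which is `commRep`.

The map `M → Ĩ` is also injective, i.e. `M ∩ M ω(L) = 0`. This is the one deep point and rests on a
Poincaré-Birkhoff-Witt action of `L` on polynomials, arranged so that the abelian ideal `M` acts by
plain multiplication. Applied to `1`, an element of `M ω(L)` then yields a polynomial without linear
part, whereas `m ∈ M` yields the linear form of `m` (`eq_zero_of_ι_mem_MOmega`).

Thus `K̃` is the range of `commRep`, which contains `D` and `D ^ 2`, and `L / C_L(M)` embeds in it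
as the span of `D`. If `D ^ 2` is a multiple of `D`, the span of `D` is the whole range, and the
natural map `M ⋊ L / C_L(M) → L̃_M` is bijective. Conversely, any isomorphism forces the range to
have the dimension of `L / C_L(M)`, at most one, so `D` and `D ^ 2` are proportional. -/

noncomputable section

namespace LieTilde

open UniversalEnvelopingAlgebra

attribute [local instance 100] LieRing.ofAssociativeRing

/-! ### The Poincaré-Birkhoff-Witt action of a Lie algebra on polynomials. -/

section PBW

open MvPolynomial Module

variable {F L κ : Type*} [Field F] [LieRing L] [LieAlgebra F L]

/-- The linear map `L → F[κ]` sending the basis vector `b i` to the variable `X i`. -/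
def linPoly (b : Basis κ F L) : L →ₗ[F] MvPolynomial κ F := b.constr F X

@[simp]
theorem linPoly_basis (b : Basis κ F L) (i : κ) : linPoly b (b i) = X i := by
  simp [linPoly]

/-- The bilinear map `(x, v) ↦ x v + T x v`, where `x v` is the product of polynomials. -/
def mulAdd (b : Basis κ F L) (T : L →ₗ[F] MvPolynomial κ F →ₗ[F] MvPolynomial κ F) :
    L →ₗ[F] MvPolynomial κ F →ₗ[F] MvPolynomial κ F :=
  (LinearMap.mul F (MvPolynomial κ F)).comp (linPoly b) + T

theorem mulAdd_apply (b : Basis κ F L) (T : L →ₗ[F] MvPolynomial κ F →ₗ[F] MvPolynomial κ F)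
    (x : L) (v : MvPolynomial κ F) : mulAdd b T x v = linPoly b x * v + T x v := rfl

theorem constr_basisMonomials (f : (κ →₀ ℕ) → MvPolynomial κ F) (d : κ →₀ ℕ) :
    (basisMonomials κ F).constr F f (monomial d 1) = f d := by
  have := (basisMonomials κ F).constr_basis F f d
  rwa [coe_basisMonomials] at this

variable (F κ) in
/-- The polynomials of degree at most `n`, as a span of monomials. -/
def degLE (n : ℕ) : Submodule F (MvPolynomial κ F) :=
  Submodule.span F {v | ∃ d : κ →₀ ℕ, d.degree ≤ n ∧ v = monomial d 1}

theorem monomial_mem_degLE {d : κ →₀ ℕ} {n : ℕ} (h : d.degree ≤ n) :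
    monomial d (1 : F) ∈ degLE F κ n := Submodule.subset_span ⟨d, h, rfl⟩

theorem degLE_mono {m n : ℕ} (h : m ≤ n) : degLE F κ m ≤ degLE F κ n := by
  refine Submodule.span_mono ?_
  rintro _ ⟨d, hd, rfl⟩
  exact ⟨d, hd.trans h, rfl⟩

theorem exists_mem_degLE (v : MvPolynomial κ F) : ∃ n, v ∈ degLE F κ n := by
  induction v using MvPolynomial.induction_on' with
  | monomial d a =>
    refine ⟨d.degree, ?_⟩
    have := Submodule.smul_mem _ a (monomial_mem_degLE (F := F) (le_refl d.degree))
    rwa [smul_monomial, smul_eq_mul, mul_one] at this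
  | add p q hp hq =>
    obtain ⟨m, hm⟩ := hp
    obtain ⟨n, hn⟩ := hq
    exact ⟨max m n, add_mem (degLE_mono (le_max_left _ _) hm) (degLE_mono (le_max_right _ _) hn)⟩

/-- By bilinearity, a claim about `f x v` with `v` of bounded degree needs checking only on basis
vectors and monomials. -/
theorem mem_of_basis {V : Type*} [AddCommGroup V] [Module F V] (b : Basis κ F L) {n : ℕ}
    (W : Submodule F V) (f : L →ₗ[F] MvPolynomial κ F →ₗ[F] V)
    (h : ∀ i, ∀ d : κ →₀ ℕ, d.degree ≤ n → f (b i) (monomial d 1) ∈ W) (x : L)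
    {v : MvPolynomial κ F} (hv : v ∈ degLE F κ n) : f x v ∈ W := by
  have h1 : ∀ i, f (b i) v ∈ W := by
    intro i
    have : degLE F κ n ≤ W.comap (f (b i)) := by
      refine Submodule.span_le.2 ?_
      rintro _ ⟨d, hd, rfl⟩
      exact h i d hd
    exact this hv
  have h2 : (⊤ : Submodule F L) ≤ W.comap (f.flip v) := by
    rw [← b.span_eq]
    refine Submodule.span_le.2 ?_
    rintro _ ⟨i, rfl⟩
    exact h1 i
  exact h2 (Submodule.mem_top (x := x))

theorem eq_of_basis {V : Type*} [AddCommGroup V] [Module F V] (b : Basis κ F L) {n : ℕ}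
    (f g : L →ₗ[F] MvPolynomial κ F →ₗ[F] V)
    (h : ∀ i, ∀ d : κ →₀ ℕ, d.degree ≤ n → f (b i) (monomial d 1) = g (b i) (monomial d 1)) (x : L)
    {v : MvPolynomial κ F} (hv : v ∈ degLE F κ n) : f x v = g x v := by
  have := mem_of_basis b ⊥ (f - g) (fun i d hd => by simp [h i d hd]) x hv
  simpa [sub_eq_zero] using this

theorem X_mul_monomial_one (i : κ) (d : κ →₀ ℕ) :
    (X i * monomial d 1 : MvPolynomial κ F) = monomial (Finsupp.single i 1 + d) 1 := by
  rw [X, monomial_mul, one_mul]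

theorem mem_support_single_add {j k : κ} {e : κ →₀ ℕ} :
    k ∈ (Finsupp.single j 1 + e).support ↔ k = j ∨ k ∈ e.support := by
  classical
  simp only [Finsupp.mem_support_iff, Finsupp.add_apply, Finsupp.single_apply]
  split_ifs with h
  · simp [h]
  · simp [Ne.symm h]

theorem linPoly_mul_mem (b : Basis κ F L) {n : ℕ} (x : L) {v : MvPolynomial κ F}
    (hv : v ∈ degLE F κ n) : linPoly b x * v ∈ degLE F κ (n + 1) := by
  refine mem_of_basis b (degLE F κ (n + 1))
    ((LinearMap.mul F (MvPolynomial κ F)).comp (linPoly b)) (fun i d hd => ?_) x hv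
  change linPoly b (b i) * monomial d 1 ∈ _
  rw [linPoly_basis, X_mul_monomial_one]
  refine monomial_mem_degLE ?_
  rw [map_add, Finsupp.degree_single]
  omega

theorem constantCoeff_linPoly (b : Basis κ F L) (x : L) : constantCoeff (linPoly b x) = 0 := by
  have : (lcoeff F (0 : κ →₀ ℕ)).comp (linPoly b) = 0 := by
    refine b.ext fun i => ?_
    simp [lcoeff]
  exact DFunLike.congr_fun this x

theorem coeff_single_linPoly (b : Basis κ F L) (x : L) (i : κ) :
    coeff (Finsupp.single i 1) (linPoly b x) = b.repr x i := by
  have : (lcoeff F (Finsupp.single i 1)).comp (linPoly b) = b.coord i := by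
    refine b.ext fun j => ?_
    classical simp [lcoeff, coeff_X, Finsupp.single_apply, Finsupp.single_left_inj]
  exact DFunLike.congr_fun this x

/-- A factorization of a degree-one monomial has a factor of degree zero, where one of the two
constant terms appears. -/
theorem coeff_single_mul {p q : MvPolynomial κ F} (hp : constantCoeff p = 0)
    (hq : constantCoeff q = 0) (i : κ) : coeff (Finsupp.single i 1) (p * q) = 0 := by
  classical
  rw [coeff_mul]
  refine Finset.sum_eq_zero fun x hx => ?_
  have h := congrArg Finsupp.degree (Finset.HasAntidiagonal.mem_antidiagonal.1 hx)
  rw [map_add, Finsupp.degree_single] at h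
  rcases Nat.eq_zero_or_pos x.1.degree with h1 | h1
  · rw [(Finsupp.degree_eq_zero_iff _).1 h1, ← constantCoeff_eq, hp, zero_mul]
  · rw [(Finsupp.degree_eq_zero_iff x.2).1 (by omega), ← constantCoeff_eq, hq, mul_zero]

theorem mulAdd_mem (b : Basis κ F L) {n : ℕ}
    {T : L →ₗ[F] MvPolynomial κ F →ₗ[F] MvPolynomial κ F}
    (hT : ∀ k ≤ n, ∀ x, ∀ v ∈ degLE F κ k, T x v ∈ degLE F κ k) (x : L) {v : MvPolynomial κ F}
    (hv : v ∈ degLE F κ n) : mulAdd b T x v ∈ degLE F κ (n + 1) :=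
  add_mem (linPoly_mul_mem b x hv) (degLE_mono n.le_succ (hT n le_rfl x v hv))

variable [LinearOrder κ]

open Classical in
/-- The correction term of the action of a basis vector on a monomial. -/
def lowMonomial (b : Basis κ F L) (T : L →ₗ[F] MvPolynomial κ F →ₗ[F] MvPolynomial κ F)
    (i : κ) (d : κ →₀ ℕ) : MvPolynomial κ F :=
  if h : d.support.Nonempty then
    if d.support.min' h < i then
      mulAdd b T ⁅b i, b (d.support.min' h)⁆
        (monomial (d - Finsupp.single (d.support.min' h) 1) 1) +
      mulAdd b T (b (d.support.min' h))
        (T (b i) (monomial (d - Finsupp.single (d.support.min' h) 1) 1))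
    else 0
  else 0

/-- The correction terms computed by recursion of depth `n`; they are final on polynomials of
degree at most `n`. -/
def lowAux (b : Basis κ F L) : ℕ → L →ₗ[F] MvPolynomial κ F →ₗ[F] MvPolynomial κ F
  | 0 => 0
  | n + 1 => b.constr F fun i => (basisMonomials κ F).constr F (lowMonomial b (lowAux b n) i)

/-- The correction terms of the Poincaré-Birkhoff-Witt action of `L` on polynomials. -/
def low (b : Basis κ F L) : L →ₗ[F] MvPolynomial κ F →ₗ[F] MvPolynomial κ F :=
  b.constr F fun i => (basisMonomials κ F).constr F
    fun d => lowAux b d.degree (b i) (monomial d 1)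

/-- The Poincaré-Birkhoff-Witt action of `L` on polynomials. -/
def act (b : Basis κ F L) : L →ₗ[F] MvPolynomial κ F →ₗ[F] MvPolynomial κ F :=
  mulAdd b (low b)

theorem lowAux_succ (b : Basis κ F L) (n : ℕ) (i : κ) (d : κ →₀ ℕ) :
    lowAux b (n + 1) (b i) (monomial d 1) = lowMonomial b (lowAux b n) i d := by
  rw [lowAux, Basis.constr_basis, constr_basisMonomials]

theorem low_monomial (b : Basis κ F L) (i : κ) (d : κ →₀ ℕ) :
    low b (b i) (monomial d 1) = lowAux b d.degree (b i) (monomial d 1) := by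
  rw [low, Basis.constr_basis, constr_basisMonomials]

theorem lowMonomial_zero (b : Basis κ F L)
    (T : L →ₗ[F] MvPolynomial κ F →ₗ[F] MvPolynomial κ F) (i : κ) : lowMonomial b T i 0 = 0 := by
  simp [lowMonomial]

theorem lowMonomial_add (b : Basis κ F L)
    (T : L →ₗ[F] MvPolynomial κ F →ₗ[F] MvPolynomial κ F) (i j : κ) (e : κ →₀ ℕ)
    (hj : ∀ k ∈ e.support, j ≤ k) :
    lowMonomial b T i (Finsupp.single j 1 + e) =
      if j < i then mulAdd b T ⁅b i, b j⁆ (monomial e 1) +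
        mulAdd b T (b j) (T (b i) (monomial e 1)) else 0 := by
  have h : (Finsupp.single j 1 + e).support.Nonempty := ⟨j, mem_support_single_add.2 (Or.inl rfl)⟩
  have hmin : (Finsupp.single j 1 + e).support.min' h = j := by
    refine le_antisymm (Finset.min'_le _ _ (mem_support_single_add.2 (Or.inl rfl))) ?_
    refine Finset.le_min' _ _ _ fun k hk => ?_
    rw [mem_support_single_add] at hk
    rcases hk with rfl | hk
    exacts [le_rfl, hj k hk]
  rw [lowMonomial, dif_pos h, hmin, add_tsub_cancel_left]

theorem exists_min_decomp (d : κ →₀ ℕ) (hd : d ≠ 0) :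
    ∃ (j : κ) (e : κ →₀ ℕ), d = Finsupp.single j 1 + e ∧ ∀ k ∈ e.support, j ≤ k := by
  have h : d.support.Nonempty := Finsupp.support_nonempty_iff.2 hd
  have hm := Finset.min'_mem _ h
  have hle : Finsupp.single (d.support.min' h) 1 ≤ d := by
    rw [Finsupp.single_le_iff]
    exact Nat.one_le_iff_ne_zero.2 (Finsupp.mem_support_iff.1 hm)
  refine ⟨d.support.min' h, d - Finsupp.single (d.support.min' h) 1,
    (add_tsub_cancel_of_le hle).symm, fun k hk => Finset.min'_le _ _ ?_⟩
  exact Finsupp.support_mono tsub_le_self hk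

/-- Corrections never raise the degree: the multiplication in them raises it by one, but acts on a
monomial from which one variable has been removed. -/
theorem lowAux_mem (b : Basis κ F L) (n : ℕ) : ∀ (k : ℕ) (x : L), ∀ v ∈ degLE F κ k,
    lowAux b n x v ∈ degLE F κ k := by
  induction n with
  | zero => intro k x v _; simp [lowAux]
  | succ n ih =>
    intro k x v hv
    refine mem_of_basis b _ _ (fun i d hd => ?_) x hv
    rw [lowAux_succ]
    rcases eq_or_ne d 0 with rfl | h0
    · rw [lowMonomial_zero]; exact zero_mem _
    obtain ⟨j, e, rfl, hj⟩ := exists_min_decomp d h0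
    rw [lowMonomial_add _ _ _ _ _ hj]
    rw [map_add, Finsupp.degree_single] at hd
    have he : monomial e (1 : F) ∈ degLE F κ e.degree := monomial_mem_degLE le_rfl
    have hle := degLE_mono (F := F) (κ := κ) (show e.degree + 1 ≤ k by omega)
    split_ifs
    · exact add_mem (hle (mulAdd_mem b (fun k _ => ih k) _ he))
        (hle (mulAdd_mem b (fun k _ => ih k) _ (ih _ _ _ he)))
    · exact zero_mem _

/-- At degree at most `n + 1` the recursion consults the previous depth only at degree at most `n`.
So depth equal to the degree suffices, and the corrections of all depths glue to `low`. -/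
theorem lowAux_stable (b : Basis κ F L) (n : ℕ) : ∀ (x : L), ∀ v ∈ degLE F κ n,
    lowAux b (n + 1) x v = lowAux b n x v := by
  induction n with
  | zero =>
    intro x v hv
    refine eq_of_basis b _ _ (fun i d hd => ?_) x hv
    obtain rfl : d = 0 := (Finsupp.degree_eq_zero_iff d).1 (Nat.le_zero.1 hd)
    rw [lowAux_succ, lowMonomial_zero]
    rfl
  | succ n ih =>
    intro x v hv
    refine eq_of_basis b _ _ (fun i d hd => ?_) x hv
    rw [lowAux_succ, lowAux_succ]
    rcases eq_or_ne d 0 with rfl | h0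
    · rw [lowMonomial_zero, lowMonomial_zero]
    obtain ⟨j, e, rfl, hj⟩ := exists_min_decomp d h0
    rw [map_add, Finsupp.degree_single] at hd
    have he : monomial e (1 : F) ∈ degLE F κ n := monomial_mem_degLE (by omega)
    rw [lowMonomial_add _ _ _ _ _ hj, lowMonomial_add _ _ _ _ _ hj, mulAdd_apply, mulAdd_apply,
      mulAdd_apply, mulAdd_apply, ih _ _ he, ih _ _ he, ih _ _ (lowAux_mem b n n _ _ he)]

theorem low_eq_lowAux (b : Basis κ F L) {n : ℕ} (x : L) {v : MvPolynomial κ F}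
    (hv : v ∈ degLE F κ n) : low b x v = lowAux b n x v := by
  refine eq_of_basis b _ _ (fun i d hd => ?_) x hv
  rw [low_monomial]
  clear hv
  induction hd with
  | refl => rfl
  | step h ih => rw [ih, lowAux_stable b _ _ _ (monomial_mem_degLE h)]

theorem low_mem (b : Basis κ F L) {n : ℕ} (x : L) {v : MvPolynomial κ F} (hv : v ∈ degLE F κ n) :
    low b x v ∈ degLE F κ n := by
  rw [low_eq_lowAux b x hv]
  exact lowAux_mem b n n x v hv

theorem act_apply (b : Basis κ F L) (x : L) (v : MvPolynomial κ F) :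
    act b x v = linPoly b x * v + low b x v := rfl

theorem low_one (b : Basis κ F L) (x : L) : low b x 1 = 0 := by
  have h : (1 : MvPolynomial κ F) ∈ degLE F κ 0 := monomial_mem_degLE (d := 0) (by simp)
  rw [low_eq_lowAux b x h]
  rfl

/-- The recursion characterizing `low`. For `j < i` it encodes the forced rule `x_i x_j e = x_j x_i
e + [x_i, x_j] e`; for `i ≤ j` the product is already ordered and needs no correction. -/
theorem low_min_add (b : Basis κ F L) (i j : κ) (e : κ →₀ ℕ) (hj : ∀ k ∈ e.support, j ≤ k) :
    low b (b i) (X j * monomial e 1) = if j < i then act b ⁅b i, b j⁆ (monomial e 1) +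
        act b (b j) (low b (b i) (monomial e 1)) else 0 := by
  have he : monomial e (1 : F) ∈ degLE F κ e.degree := monomial_mem_degLE le_rfl
  rw [X_mul_monomial_one, low_monomial, map_add, Finsupp.degree_single, add_comm 1, lowAux_succ,
    lowMonomial_add _ _ _ _ _ hj, act_apply, act_apply, mulAdd_apply, mulAdd_apply,
    low_eq_lowAux b _ he, low_eq_lowAux b _ he, low_eq_lowAux b _ (lowAux_mem b _ _ _ _ he)]

theorem low_of_le (b : Basis κ F L) (i : κ) (d : κ →₀ ℕ) (hi : ∀ k ∈ d.support, i ≤ k) :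
    low b (b i) (monomial d 1) = 0 := by
  rcases eq_or_ne d 0 with rfl | h0
  · exact low_one b (b i)
  obtain ⟨j, e, rfl, hj⟩ := exists_min_decomp d h0
  rw [← X_mul_monomial_one, low_min_add _ _ _ _ hj, if_neg]
  exact not_lt.2 (hi j (mem_support_single_add.2 (Or.inl rfl)))

/-- The obstruction to `act b` being a Lie algebra action. -/
theorem act_act_sub (b : Basis κ F L) (x y : L) (v : MvPolynomial κ F) :
    act b x (act b y v) - act b y (act b x v) - act b ⁅x, y⁆ v =
      low b x (linPoly b y * v) - low b y (linPoly b x * v) - act b ⁅x, y⁆ v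
        + act b x (low b y v) - act b y (low b x v) := by
  rw [act_apply b y v, act_apply b x v, map_add, map_add, act_apply b x (_ * _),
    act_apply b y (_ * _)]
  ring

/-- If `k` is at most every index in `d`, the relation is the defining recursion. Otherwise the
least variable `X j` has `j < k < i`; pulling it out as the action of `b j` leaves a combination of
relations in lower degree and the Jacobi identity. -/
theorem act_lie_monomial (b : Basis κ F L) {n : ℕ}
    (ih : ∀ m < n, ∀ v ∈ degLE F κ m, ∀ x y,
      act b x (act b y v) - act b y (act b x v) - act b ⁅x, y⁆ v = 0)
    (i k : κ) (hik : k < i) (d : κ →₀ ℕ) (hd : d.degree ≤ n) :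
    act b (b i) (act b (b k) (monomial d 1)) - act b (b k) (act b (b i) (monomial d 1))
      - act b ⁅b i, b k⁆ (monomial d 1) = 0 := by
  by_cases hk : ∀ l ∈ d.support, k ≤ l
  · rw [act_act_sub, linPoly_basis, linPoly_basis, low_min_add _ _ _ _ hk, if_pos hik,
      low_of_le b k d hk, X_mul_monomial_one, low_of_le b k (Finsupp.single i 1 + d)]
    · simp
    · intro l hl
      rw [mem_support_single_add] at hl
      rcases hl with rfl | hl
      exacts [hik.le, hk l hl]
  · have h0 : d ≠ 0 := by rintro rfl; simp at hk
    obtain ⟨j, e, rfl, hj⟩ := exists_min_decomp d h0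
    have hjk : j < k := by
      by_contra h
      refine hk fun l hl => ?_
      rw [mem_support_single_add] at hl
      rcases hl with rfl | hl
      exacts [not_lt.1 h, (not_lt.1 h).trans (hj l hl)]
    have hji := hjk.trans hik
    rw [map_add, Finsupp.degree_single] at hd
    have he : monomial e (1 : F) ∈ degLE F κ e.degree := monomial_mem_degLE le_rfl
    have hlt : e.degree < n := by omega
    have hj' : ∀ p, j < p → ∀ l ∈ (Finsupp.single p 1 + e).support, j ≤ l := by
      intro p hp l hl
      rw [mem_support_single_add] at hl
      rcases hl with rfl | hl
      exacts [hp.le, hj l hl]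
    -- The index `j` is still minimal after multiplication by `X q`, so the recursion peels off `X
    -- j` and not `X q`.
    have hswap : ∀ p q, j < p → j < q → low b (b p) (X q * monomial (Finsupp.single j 1 + e) 1) =
        act b ⁅b p, b j⁆ (X q * monomial e 1) + act b (b j) (low b (b p) (X q * monomial e 1)) := by
      intro p q hp hq
      rw [← X_mul_monomial_one, mul_left_comm, X_mul_monomial_one q, low_min_add _ _ _ _ (hj' q hq),
        if_pos hp]
    have hJ : act b (b j) (monomial e 1) = monomial (Finsupp.single j 1 + e) 1 := by
      rw [act_apply, low_of_le b j e hj, linPoly_basis, X_mul_monomial_one, add_zero]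
    have hX : ∀ p, X p * monomial e 1 =
        act b (b p) (monomial e 1) - low b (b p) (monomial e 1) := by
      intro p
      rw [act_apply, linPoly_basis, add_sub_cancel_right]
    have hl : ∀ p, j < p → low b (b p) (monomial (Finsupp.single j 1 + e) 1) =
        act b ⁅b p, b j⁆ (monomial e 1) + act b (b j) (low b (b p) (monomial e 1)) := by
      intro p hp
      rw [← X_mul_monomial_one, low_min_add _ _ _ _ hj, if_pos hp]
    -- The relation for `b i`, `b k` on the shorter monomial `e` lets `low b (b i) (X k * e)` be
    -- traded for `low b (b k) (X i * e)`.
    have hP := act_act_sub b (b i) (b k) (monomial e 1)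
    rw [ih _ hlt _ he, linPoly_basis, linPoly_basis] at hP
    have hA : low b (b i) (X k * monomial e 1) = low b (b k) (X i * monomial e 1)
        + act b ⁅b i, b k⁆ (monomial e 1)
        - act b (b i) (low b (b k) (monomial e 1)) + act b (b k) (low b (b i) (monomial e 1)) := by
      linear_combination -hP
    rw [act_act_sub, linPoly_basis, linPoly_basis, hswap i k hji hjk, hswap k i hjk hji, hA,
      hl i hji, hl k hjk, ← hJ, hX, hX]
    simp only [map_add, map_sub]
    -- Induction applies to the corrections as well as to `e` because `low` does not raise the
    -- degree.
    have c1 := ih _ hlt _ (low_mem b (b k) he) (b i) (b j)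
    have c2 := ih _ hlt _ (low_mem b (b i) he) (b k) (b j)
    have c3 := ih _ hlt _ he ⁅b i, b j⁆ (b k)
    have c4 := ih _ hlt _ he ⁅b k, b j⁆ (b i)
    have c5 := ih _ hlt _ he ⁅b i, b k⁆ (b j)
    have jac : act b ⁅⁅b i, b j⁆, b k⁆ (monomial e 1) - act b ⁅⁅b k, b j⁆, b i⁆ (monomial e 1)
        - act b ⁅⁅b i, b k⁆, b j⁆ (monomial e 1) = 0 := by
      rw [← LinearMap.sub_apply, ← LinearMap.sub_apply, ← map_sub, ← map_sub]
      have : ⁅⁅b i, b j⁆, b k⁆ - ⁅⁅b k, b j⁆, b i⁆ - ⁅⁅b i, b k⁆, b j⁆ = 0 := by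
        rw [lie_lie (b i) (b k) (b j), ← lie_skew (b k) ⁅b i, b j⁆, ← lie_skew (b i) ⁅b k, b j⁆]
        abel
      rw [this]; simp
    linear_combination c1 - c2 + c3 - c4 - c5 + jac

theorem act_lie (b : Basis κ F L) (x y : L) (v : MvPolynomial κ F) :
    act b ⁅x, y⁆ v = act b x (act b y v) - act b y (act b x v) := by
  suffices H : ∀ n, ∀ v ∈ degLE F κ n, ∀ x y,
      act b x (act b y v) - act b y (act b x v) - act b ⁅x, y⁆ v = 0 by
    obtain ⟨n, hn⟩ := exists_mem_degLE v
    exact (sub_eq_zero.1 (H n v hn x y)).symm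
  intro n
  induction n using Nat.strong_induction_on with
  | _ n ih =>
    intro v hv x y
    -- The obstruction to the bracket relation is bilinear and alternating in `x`, `y`, so only
    -- pairs `b i`, `b k` with `k < i` matter.
    let G : L →ₗ[F] L →ₗ[F] MvPolynomial κ F →ₗ[F] MvPolynomial κ F :=
      LinearMap.mk₂ F (fun x y => (act b x).comp (act b y) - (act b y).comp (act b x)
          - act b ⁅x, y⁆)
        (fun x x' y => by
          simp only [map_add, LinearMap.add_comp, LinearMap.comp_add, add_lie]; abel)
        (fun c x y => by
          simp only [map_smul, LinearMap.smul_comp, LinearMap.comp_smul, smul_lie, smul_sub])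
        (fun x y y' => by
          simp only [map_add, LinearMap.add_comp, LinearMap.comp_add, lie_add]; abel)
        (fun c x y => by
          simp only [map_smul, LinearMap.smul_comp, LinearMap.comp_smul, lie_smul, smul_sub])
    have hb : ∀ i k, ∀ d : κ →₀ ℕ, d.degree ≤ n → G (b i) (b k) (monomial d 1) = 0 := by
      intro i k d hd
      change act b (b i) (act b (b k) (monomial d 1)) - act b (b k) (act b (b i) (monomial d 1))
        - act b ⁅b i, b k⁆ (monomial d 1) = 0
      rcases lt_trichotomy i k with h | rfl | h
      · have := act_lie_monomial b ih k i h d hd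
        rw [← lie_skew, map_neg, LinearMap.neg_apply]
        linear_combination -this
      · simp
      · exact act_lie_monomial b ih i k h d hd
    have hb' : ∀ k, G x (b k) v = 0 := fun k =>
      eq_of_basis b (G.flip (b k)) 0 (fun i d hd => hb i k d hd) x hv
    have : (G x).flip v = 0 := b.ext hb'
    exact DFunLike.congr_fun this y

/-- The Poincaré-Birkhoff-Witt action as a homomorphism of Lie algebras. -/
def actHom (b : Basis κ F L) : L →ₗ⁅F⁆ Module.End F (MvPolynomial κ F) where
  toLinearMap := act b
  map_lie' {x y} := LinearMap.ext fun v => act_lie b x y v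

/-- The Poincaré-Birkhoff-Witt action of `U(L)` on polynomials. -/
def actU (b : Basis κ F L) :
    UniversalEnvelopingAlgebra F L →ₐ[F] Module.End F (MvPolynomial κ F) :=
  lift F (actHom b)

theorem actU_ι (b : Basis κ F L) (x : L) : actU b (ι F x) = act b x := lift_ι_apply F _ _

theorem constantCoeff_lowAux (b : Basis κ F L) (n : ℕ) (x : L) (v : MvPolynomial κ F) :
    constantCoeff (lowAux b n x v) = 0 := by
  induction n generalizing x v with
  | zero => simp [lowAux]
  | succ n ih =>
    obtain ⟨m, hm⟩ := exists_mem_degLE v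
    refine mem_of_basis b (LinearMap.ker (lcoeff F (0 : κ →₀ ℕ))) (lowAux b (n + 1))
      (fun i d _ => ?_) x hm
    change constantCoeff _ = 0
    have h : ∀ x v, constantCoeff (mulAdd b (lowAux b n) x v) = 0 := fun x v => by
      rw [mulAdd_apply, map_add, map_mul, ih, constantCoeff_linPoly, zero_mul, add_zero]
    rw [lowAux_succ, lowMonomial]
    split_ifs <;> simp [h]

theorem constantCoeff_act (b : Basis κ F L) (x : L) (v : MvPolynomial κ F) :
    constantCoeff (act b x v) = 0 := by
  obtain ⟨n, hn⟩ := exists_mem_degLE v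
  rw [act_apply, map_add, map_mul, constantCoeff_linPoly, low_eq_lowAux b x hn,
    constantCoeff_lowAux, zero_mul, add_zero]

/-- Elements of `L` produce polynomials without constant term, so the constant term is a module map
onto the trivial module, on which `U(L)` acts through the augmentation. -/
theorem constantCoeff_actU (b : Basis κ F L) (u : UniversalEnvelopingAlgebra F L)
    (v : MvPolynomial κ F) : constantCoeff (actU b u v) = augmentation F L u * constantCoeff v := by
  induction u using U_induction generalizing v with
  | hs c => simp [Module.algebraMap_end_apply, smul_eq_C_mul]
  | hι x => rw [actU_ι, constantCoeff_act, augmentation, lift_ι_apply]; simp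
  | hm a b iha ihb => rw [map_mul, Module.End.mul_apply, iha, ihb, map_mul, mul_assoc]
  | ha a b iha ihb => rw [map_add, LinearMap.add_apply, map_add, iha, ihb, map_add, add_mul]

/-- Moving `b i` past a variable only meets smaller indices. These lie in the initial segment `S`,
so every commutator that could create a correction vanishes. -/
theorem low_eq_zero_of_comm (b : Basis κ F L) (S : Set κ) (hS : ∀ i ∈ S, ∀ j < i, j ∈ S)
    (hc : ∀ i ∈ S, ∀ j ∈ S, ⁅b i, b j⁆ = 0) {i : κ} (hi : i ∈ S) : low b (b i) = 0 := by
  refine (basisMonomials κ F).ext fun d => ?_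
  rw [coe_basisMonomials, LinearMap.zero_apply]
  change low b (b i) (monomial d 1) = 0
  generalize hn : d.degree = n
  induction n generalizing d with
  | zero =>
    obtain rfl : d = 0 := (Finsupp.degree_eq_zero_iff d).1 hn
    exact low_one b (b i)
  | succ n ih =>
    have h0 : d ≠ 0 := by rintro rfl; simp at hn
    obtain ⟨j, e, rfl, hj⟩ := exists_min_decomp d h0
    rw [map_add, Finsupp.degree_single] at hn
    rw [← X_mul_monomial_one, low_min_add _ _ _ _ hj]
    split_ifs with h
    · rw [hc i hi j (hS i hi j h), ih e (by omega)]
      simp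
    · rfl

end PBW

/-! ### The intersection of `M` with `M ω(L)`. -/

section Injectivity

open MvPolynomial Module

variable {F L : Type*} [Field F] [LieRing L] [LieAlgebra F L]

/-- Every subspace is spanned by an initial segment of a suitable ordered basis. -/
theorem exists_basis_initial_segment.{v} {V : Type v} [AddCommGroup V] [Module F V]
    (W : Submodule F V) :
    ∃ (κ : Type v) (_ : LinearOrder κ) (b : Basis κ F V) (S : Set κ),
      (∀ i ∈ S, ∀ j < i, j ∈ S) ∧ Submodule.span F (b '' S) = W := by
  obtain ⟨N, hN⟩ := Submodule.exists_isCompl W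
  let bW := Basis.ofVectorSpace F W
  let bN := Basis.ofVectorSpace F N
  let _ : LinearOrder (Basis.ofVectorSpaceIndex F W) := IsWellOrder.linearOrder WellOrderingRel
  let _ : LinearOrder (Basis.ofVectorSpaceIndex F N) := IsWellOrder.linearOrder WellOrderingRel
  -- The lexicographic sum places the basis of `W` before that of its complement.
  let b : Basis (Basis.ofVectorSpaceIndex F W ⊕ₗ Basis.ofVectorSpaceIndex F N) F V :=
    ((bW.prod bN).map (Submodule.prodEquivOfIsCompl _ _ hN)).reindex toLex
  have hb : ∀ i, b (toLex (Sum.inl i)) = (bW i : V) := fun i => by simp [b]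
  refine ⟨_, inferInstance, b, Set.range fun i => toLex (Sum.inl i), ?_, ?_⟩
  · rintro _ ⟨i, rfl⟩ j hj
    rcases j with j | j
    · exact ⟨j, rfl⟩
    · exact absurd hj (Sum.Lex.not_inr_lt_inl)
  · rw [← Set.range_comp]
    have : (b ∘ fun i => toLex (Sum.inl i)) = W.subtype ∘ bW := funext hb
    rw [this, Set.range_comp, Submodule.span_image, bW.span_eq, Submodule.map_subtype_top]

/-- For an abelian ideal `M`, the intersection of `M` with `M ω(L)` is zero. -/
theorem eq_zero_of_ι_mem_MOmega (M : LieIdeal F L) [IsLieAbelian M] {m : L}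
    (h : ι F m ∈ MOmega M) : m = 0 := by
  obtain ⟨κ, _, b, S, hS, hspan⟩ := exists_basis_initial_segment M.toSubmodule
  have hmem : ∀ i ∈ S, b i ∈ M := fun i hi =>
    hspan.le (Submodule.subset_span (Set.mem_image_of_mem b hi))
  -- Since `M` is abelian and spanned by an initial segment, it acts by multiplication alone.
  have hlow : ∀ y ∈ M, low b y = 0 := by
    have : Submodule.span F (b '' S) ≤ LinearMap.ker (low b) := by
      refine Submodule.span_le.2 ?_
      rintro _ ⟨i, hi, rfl⟩
      refine low_eq_zero_of_comm b S hS (fun i hi j hj => ?_) hi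
      exact congrArg Subtype.val (trivial_lie_zero M M ⟨b i, hmem i hi⟩ ⟨b j, hmem j hj⟩)
    exact fun y hy => this (hspan.ge hy)
  -- For `y ∈ M` and `u ∈ ω(L)`, `y u` sends `1` to a product of two polynomials without constant
  -- term, so no linear part survives.
  have key : ∀ a ∈ MOmega M, ∀ i, coeff (Finsupp.single i 1) (actU b a 1) = 0 := by
    intro a ha i
    induction ha using Submodule.mul_induction_on' with
    | mem_mul_mem y hy u hu =>
      obtain ⟨y, hy, rfl⟩ := hy
      change coeff _ (actU b (ι F y * u) 1) = 0
      rw [map_mul, actU_ι, Module.End.mul_apply, act_apply, hlow y hy, LinearMap.zero_apply,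
        add_zero]
      refine coeff_single_mul (constantCoeff_linPoly b y) ?_ i
      rw [constantCoeff_actU, (mem_omega u).1 hu, zero_mul]
    | add a _ c _ ha hc => rw [map_add, LinearMap.add_apply, coeff_add, ha, hc, add_zero]
  refine b.repr.map_eq_zero_iff.1 (Finsupp.ext fun i => ?_)
  have := key _ h i
  rwa [actU_ι, act_apply, low_one, mul_one, add_zero, coeff_single_linPoly] at this

end Injectivity

/-! ### Identification of `Ĩ` with `M` and of `K̃` with operators on `M`. -/

section Structure

open Module

variable {F L : Type*} [Field F] [LieRing L] [LieAlgebra F L] (M : LieIdeal F L)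

theorem ι_mem_MU {m : L} (hm : m ∈ M) : ι F m ∈ MU M := by
  have : ι F m * 1 ∈ imU M * ⊤ := Submodule.mul_mem_mul ⟨m, hm, rfl⟩ Submodule.mem_top
  rwa [mul_one] at this

/-- The linear map `M → Ĩ`. -/
def toITilde : M →ₗ[F] ITilde M :=
  (ITilde.mk M).comp
    (((ι F : L →ₗ⁅F⁆ UniversalEnvelopingAlgebra F L).toLinearMap.comp
      M.toSubmodule.subtype).codRestrict (MU M) fun m => ι_mem_MU M m.2)

theorem toITilde_apply (m : M) : toITilde M m = ITilde.mk M ⟨ι F (m : L), ι_mem_MU M m.2⟩ := rfl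

variable {M}

theorem ITilde.mk_eq_mk {a b : MU M} :
    ITilde.mk M a = ITilde.mk M b ↔
      (a : UniversalEnvelopingAlgebra F L) - (b : UniversalEnvelopingAlgebra F L) ∈ MOmega M :=
  Submodule.Quotient.eq _

theorem ITilde.mk_surjective : Function.Surjective (ITilde.mk M) := Submodule.mkQ_surjective _

theorem sub_augmentation_mem_omega (u : UniversalEnvelopingAlgebra F L) :
    u - algebraMap F _ (augmentation F L u) ∈ omega F L := by
  rw [mem_omega, map_sub, AlgHom.commutes]
  exact sub_self _

theorem ι_mul_sub_smul_mem_MOmega {m : L} (hm : m ∈ M) (u : UniversalEnvelopingAlgebra F L) :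
    ι F m * u - augmentation F L u • ι F m ∈ MOmega M := by
  have : ι F m * u - augmentation F L u • ι F m =
      ι F m * (u - algebraMap F _ (augmentation F L u)) := by
    rw [mul_sub, ← Algebra.commutes, ← Algebra.smul_def]
  rw [this]
  exact Submodule.mul_mem_mul ⟨m, hm, rfl⟩ (sub_augmentation_mem_omega u)

variable (M) in
/-- The representation of `U(L)` on `M` extending the adjoint action. -/
def repU : UniversalEnvelopingAlgebra F L →ₐ[F] Module.End F M :=
  lift F (LieModule.toEnd F L M)

theorem repU_ι (y : L) : repU M (ι F y) = LieModule.toEnd F L M y := lift_ι_apply F _ _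

theorem mul_ι_sub_mem_MOmega (u : UniversalEnvelopingAlgebra F L) (m : M) :
    u * ι F (m : L) - ι F (repU M u m : L) ∈ MOmega M := by
  induction u using U_induction generalizing m with
  | hs c =>
    rw [AlgHom.commutes, Module.algebraMap_end_apply, ← Algebra.smul_def]
    simp
  | hι y =>
    have h : ι F y * ι F (m : L) - ι F (repU M (ι F y) m : L) = ι F (m : L) * ι F y := by
      rw [repU_ι, LieModule.toEnd_apply_apply]
      change ι F y * ι F (m : L) - ι F ⁅y, (m : L)⁆ = _
      rw [LieHom.map_lie, LieRing.of_associative_ring_bracket]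
      abel
    rw [h]
    exact Submodule.mul_mem_mul ⟨m, m.2, rfl⟩ (ι_mem_omega y)
  | hm a c iha ihc =>
    have h := mul_mem_left_aux M (omega F L) (fun w _ h => omega_mul_mem_left w h) a _ (ihc m)
    have h' := add_mem h (iha (repU M c m))
    rw [map_mul, Module.End.mul_apply]
    rwa [mul_sub, sub_add_sub_cancel, ← mul_assoc] at h'
  | ha a c iha ihc =>
    have h := add_mem (iha m) (ihc m)
    rw [map_add, LinearMap.add_apply, LieSubmodule.coe_add, map_add, add_mul]
    rwa [sub_add_sub_comm] at h

theorem toITilde_surjective : Function.Surjective (toITilde M) := by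
  intro z
  obtain ⟨⟨a, ha⟩, rfl⟩ := ITilde.mk_surjective z
  suffices H : ∃ m : M, ι F (m : L) - a ∈ MOmega M by
    obtain ⟨m, hm⟩ := H
    exact ⟨m, ITilde.mk_eq_mk.2 hm⟩
  induction ha using Submodule.mul_induction_on' with
  | mem_mul_mem y hy u hu =>
    obtain ⟨y, hy, rfl⟩ := hy
    refine ⟨augmentation F L u • ⟨y, hy⟩, ?_⟩
    have := neg_mem (ι_mul_sub_smul_mem_MOmega hy u)
    rw [neg_sub] at this
    simpa using this
  | add a _ c _ ha hc =>
    obtain ⟨m, hm⟩ := ha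
    obtain ⟨m', hm'⟩ := hc
    refine ⟨m + m', ?_⟩
    have := add_mem hm hm'
    rw [sub_add_sub_comm] at this
    simpa using this

theorem toITilde_injective [IsLieAbelian M] : Function.Injective (toITilde M) := by
  rw [injective_iff_map_eq_zero]
  intro m hm
  rw [← map_zero (ITilde.mk M), toITilde_apply, ITilde.mk_eq_mk] at hm
  refine Subtype.ext (eq_zero_of_ι_mem_MOmega M ?_)
  simpa using hm

variable (M) in
/-- The isomorphism `M ≃ Ĩ` for an abelian ideal `M`. -/
def equivITilde [IsLieAbelian M] : M ≃ₗ[F] ITilde M :=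
  LinearEquiv.ofBijective (toITilde M) ⟨toITilde_injective, toITilde_surjective⟩

variable (M) in
/-- The action of `U(L)` on `M` by commutators modulo `M ω(L)`. -/
def commRep : UniversalEnvelopingAlgebra F L →ₗ[F] Module.End F M :=
  (repU M).toLinearMap - (augmentation F L).toLinearMap.smulRight 1

theorem commRep_apply (u : UniversalEnvelopingAlgebra F L) :
    commRep M u = repU M u - augmentation F L u • 1 := rfl

theorem commRep_ι (y : L) : commRep M (ι F y) = LieModule.toEnd F L M y := by
  rw [commRep_apply, repU_ι, augmentation, lift_ι_apply]
  simp

theorem commRep_algebraMap (c : F) : commRep M (algebraMap F _ c) = 0 := by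
  rw [commRep_apply, AlgHom.commutes, AlgHom.commutes, Algebra.algebraMap_eq_smul_one]
  exact sub_self _

/-- Expand the multiplicativity of `repU` after writing it as `commRep` plus the scalar `ε`.
Consequently a subspace of operators closed under composition absorbs `commRep` of products. -/
theorem commRep_mul (u v : UniversalEnvelopingAlgebra F L) :
    commRep M (u * v) = commRep M u * commRep M v + augmentation F L u • commRep M v
      + augmentation F L v • commRep M u := by
  simp only [commRep_apply, map_mul, sub_mul, mul_sub, smul_mul_assoc, mul_smul_comm, one_mul,
    mul_one, smul_sub, smul_smul, mul_comm (augmentation F L v)]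
  abel

theorem beta_toITilde (u : UniversalEnvelopingAlgebra F L) (m : M) :
    beta M u (toITilde M m) = toITilde M (commRep M u m) := by
  rw [toITilde_apply, toITilde_apply, beta_mk, ITilde.mk_eq_mk, commRep_apply]
  change u * ι F (m : L) - ι F (m : L) * u - _ ∈ _
  have := sub_mem (mul_ι_sub_mem_MOmega u m) (ι_mul_sub_smul_mem_MOmega m.2 u)
  convert this using 1
  simp
  abel

theorem mem_J_iff [IsLieAbelian M] (u : UniversalEnvelopingAlgebra F L) :
    u ∈ J M ↔ commRep M u = 0 := by
  rw [J, LieHom.mem_ker]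
  constructor
  · intro h
    ext1 m
    apply toITilde_injective
    rw [← beta_toITilde, h]
    simp
  · intro h
    ext1 z
    obtain ⟨m, rfl⟩ := toITilde_surjective z
    rw [beta_toITilde, h]
    simp

theorem ker_commRep [IsLieAbelian M] : LinearMap.ker (commRep M) = (J M).toSubmodule := by
  ext u
  exact (mem_J_iff u).symm

theorem mem_centralizer_iff (y : L) : y ∈ centralizer M ↔ LieModule.toEnd F L M y = 0 := by
  constructor
  · intro h
    ext m
    exact h m m.2
  · intro h m hm
    exact congrArg Subtype.val (DFunLike.congr_fun h ⟨m, hm⟩)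

variable (M) in
/-- The linear isomorphism between `K̃` and the space of operators on `M` it induces. -/
def equivKTilde [IsLieAbelian M] : KTilde M ≃ₗ[F] LinearMap.range (commRep M) :=
  (Submodule.quotEquivOfEq _ _ ker_commRep.symm).trans (commRep M).quotKerEquivRange

variable (M) in
/-- The homomorphism `L / C_L(M) → K̃` induced by `L → U(L)`. -/
def quotToKTilde [IsLieAbelian M] : (L ⧸ centralizer M) →ₗ⁅F⁆ KTilde M :=
  quotLift (centralizer M)
    { toLinearMap := (J M).toSubmodule.mkQ.comp
        (ι F : L →ₗ⁅F⁆ UniversalEnvelopingAlgebra F L).toLinearMap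
      map_lie' := fun {y z} => by
        change LieSubmodule.Quotient.mk (ι F ⁅y, z⁆) =
          (⁅LieSubmodule.Quotient.mk (ι F y), LieSubmodule.Quotient.mk (ι F z)⁆ : KTilde M)
        rw [LieHom.map_lie, LieSubmodule.Quotient.mk_bracket] }
    (fun y hy => by
      refine (Submodule.Quotient.mk_eq_zero _).2 ?_
      change ι F y ∈ J M
      rw [mem_J_iff, commRep_ι]
      exact (mem_centralizer_iff y).1 hy)

theorem quotToKTilde_mk [IsLieAbelian M] (y : L) :
    quotToKTilde M (LieSubmodule.Quotient.mk y) = LieSubmodule.Quotient.mk (ι F y) := rfl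

theorem quotToKTilde_injective [IsLieAbelian M] : Function.Injective (quotToKTilde M) := by
  rw [injective_iff_map_eq_zero]
  intro z hz
  induction z using Submodule.Quotient.induction_on with
  | _ y =>
    refine (Submodule.Quotient.mk_eq_zero _).2 ((mem_centralizer_iff y).2 ?_)
    have : ι F y ∈ J M := (Submodule.Quotient.mk_eq_zero _).1 hz
    rwa [mem_J_iff, commRep_ι] at this

theorem toEnd_mem_span {x : L}
    (hx : IsCompl (centralizer M).toSubmodule (Submodule.span F {x})) (y : L) :
    LieModule.toEnd F L M y ∈ Submodule.span F {LieModule.toEnd F L M x} := by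
  obtain ⟨c, hc, s, hs, rfl⟩ := Submodule.mem_sup.1 (hx.sup_eq_top ▸ Submodule.mem_top (x := y))
  obtain ⟨t, rfl⟩ := Submodule.mem_span_singleton.1 hs
  rw [map_add, (mem_centralizer_iff c).1 hc, zero_add, map_smul]
  exact Submodule.smul_mem _ _ (Submodule.mem_span_singleton_self _)

/-- The quadratic relation makes the line of `ad x` closed under composition, so it contains the
images of all products once it contains those of `L`. -/
theorem commRep_mem_span {x : L}
    (hx : IsCompl (centralizer M).toSubmodule (Submodule.span F {x})) {c : F}
    (hc : LieModule.toEnd F L M x ^ 2 = c • LieModule.toEnd F L M x)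
    (u : UniversalEnvelopingAlgebra F L) :
    commRep M u ∈ Submodule.span F {LieModule.toEnd F L M x} := by
  induction u using U_induction with
  | hs c => rw [commRep_algebraMap]; exact zero_mem _
  | hι y => rw [commRep_ι]; exact toEnd_mem_span hx y
  | hm a b iha ihb =>
    rw [commRep_mul]
    refine add_mem (add_mem ?_ (Submodule.smul_mem _ _ ihb)) (Submodule.smul_mem _ _ iha)
    obtain ⟨s, hs⟩ := Submodule.mem_span_singleton.1 iha
    obtain ⟨t, ht⟩ := Submodule.mem_span_singleton.1 ihb
    rw [← hs, ← ht, smul_mul_smul_comm, ← pow_two, hc]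
    exact Submodule.smul_mem _ _ (Submodule.smul_mem _ _ (Submodule.mem_span_singleton_self _))
  | ha a b iha ihb => rw [map_add]; exact add_mem iha ihb

theorem quotToKTilde_surjective [IsLieAbelian M] {x : L}
    (hx : IsCompl (centralizer M).toSubmodule (Submodule.span F {x})) {c : F}
    (hc : LieModule.toEnd F L M x ^ 2 = c • LieModule.toEnd F L M x) :
    Function.Surjective (quotToKTilde M) := by
  intro z
  induction z using Submodule.Quotient.induction_on with
  | _ u =>
    obtain ⟨t, ht⟩ := Submodule.mem_span_singleton.1 (commRep_mem_span hx hc u)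
    refine ⟨LieSubmodule.Quotient.mk (t • x), ?_⟩
    rw [quotToKTilde_mk]
    refine (Submodule.Quotient.eq _).2 ?_
    change _ ∈ J M
    rw [mem_J_iff, map_sub, commRep_ι, map_smul, ht, sub_self]

/-- The homomorphism `M ⋊ L / C_L(M) → L̃_M` induced by `L → U(L)`. -/
def semidirectToLTilde [IsLieAbelian M] :
    LieAlgebra.SemiDirectSum M (L ⧸ centralizer M) (adQuot M) →ₗ⁅F⁆ LTilde M where
  toFun p := ⟨toITilde M p.left, quotToKTilde M p.right⟩
  map_add' p q := by simp
  map_smul' c p := by simp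
  map_lie' {p q} := by
    have key : ∀ (z : L ⧸ centralizer M) (m : M),
        toITilde M (adQuot M z m) = betaTilde M (quotToKTilde M z) (toITilde M m) := by
      intro z m
      induction z using Submodule.Quotient.induction_on with
      | _ y =>
        change toITilde M (LieModule.toEnd F L M y m) = beta M (ι F y) (toITilde M m)
        rw [beta_toITilde, commRep_ι]
    ext1
    · simp only [LieAlgebra.SemiDirectSum.lie_eq_mk, map_sub, map_add, key, trivial_lie_zero,
        map_zero]
    · simp only [LieAlgebra.SemiDirectSum.lie_eq_mk, LieHom.map_lie]

theorem finrank_quotient_centralizer_le_one [Module.Finite F L] {x : L}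
    (hx : IsCompl (centralizer M).toSubmodule (Submodule.span F {x})) :
    finrank F (L ⧸ centralizer M) ≤ 1 :=
  (Submodule.quotientEquivOfIsCompl _ _ hx).finrank_eq.trans_le
    ((finrank_span_le_card {x}).trans (by simp))

/-- A dimension count: cancelling `dim Ĩ = dim M` leaves the range of `commRep` with dimension at
most one, and both `ad x` and its square lie there. -/
theorem exists_sq_eq_smul [Module.Finite F L] [IsLieAbelian M] {x : L}
    (hx : IsCompl (centralizer M).toSubmodule (Submodule.span F {x}))
    (e : LTilde M ≃ₗ⁅F⁆ LieAlgebra.SemiDirectSum M (L ⧸ centralizer M) (adQuot M)) :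
    ∃ c : F, LieModule.toEnd F L M x ^ 2 = c • LieModule.toEnd F L M x := by
  -- Only the linear isomorphism underlying `e` is needed.
  let e' : (ITilde M × KTilde M) ≃ₗ[F] M × (L ⧸ centralizer M) :=
    ((LieAlgebra.SemiDirectSum.toProdl (betaTilde M)).symm.trans e.toLinearEquiv).trans
      (LieAlgebra.SemiDirectSum.toProdl (adQuot M))
  let e'' : (ITilde M × KTilde M) ≃ₗ[F] M × LinearMap.range (commRep M) :=
    (equivITilde M).symm.prodCongr (equivKTilde M)
  have : Module.Finite F M := inferInstanceAs (Module.Finite F M.toSubmodule)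
  have : Module.Finite F (L ⧸ centralizer M) :=
    inferInstanceAs (Module.Finite F (L ⧸ (centralizer M).toSubmodule))
  have h := (e''.symm.trans e').finrank_eq
  rw [finrank_prod, finrank_prod] at h
  have h1 : finrank F (LinearMap.range (commRep M)) ≤ 1 := by
    have := finrank_quotient_centralizer_le_one hx
    omega
  have hD : LieModule.toEnd F L M x ∈ LinearMap.range (commRep M) := ⟨ι F x, commRep_ι x⟩
  have hD2 : LieModule.toEnd F L M x ^ 2 ∈ LinearMap.range (commRep M) := by
    -- As `ε(x) = 0`, the cross terms in `commRep_mul` vanish.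
    refine ⟨ι F x * ι F x, ?_⟩
    rw [commRep_mul, commRep_ι, (mem_omega _).1 (ι_mem_omega x), pow_two]
    simp
  by_cases h0 : LieModule.toEnd F L M x = 0
  · exact ⟨0, by rw [h0]; simp⟩
  obtain ⟨v, hv⟩ := finrank_le_one_iff.1 h1
  obtain ⟨s, hs⟩ := hv ⟨_, hD⟩
  obtain ⟨t, ht⟩ := hv ⟨_, hD2⟩
  have hs' : s • (v : Module.End F M) = LieModule.toEnd F L M x := congrArg Subtype.val hs
  have ht' : t • (v : Module.End F M) = LieModule.toEnd F L M x ^ 2 := congrArg Subtype.val ht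
  have hs0 : s ≠ 0 := by
    rintro rfl
    exact h0 (by rw [← hs', zero_smul])
  -- With `ad x = s v` and `(ad x)² = t v`, the ratio is `t / s`.
  exact ⟨t * s⁻¹, by rw [← ht', ← hs', smul_smul, inv_mul_cancel_right₀ hs0]⟩

end Structure

end LieTilde

end

theorem mainTheorem10 {F L : Type*} [Field F] [LieRing L] [LieAlgebra F L] [Module.Finite F L]
    (M : LieIdeal F L) [IsLieAbelian M] (x : L)
    (hx : IsCompl (LieTilde.centralizer M).toSubmodule (Submodule.span F {x})) :
    Nonempty (LieTilde.LTilde M ≃ₗ⁅F⁆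
        LieAlgebra.SemiDirectSum M (L ⧸ LieTilde.centralizer M) (LieTilde.adQuot M)) ↔
      ∃ c : F, (LieModule.toEnd F L M x) ^ 2 = c • LieModule.toEnd F L M x := by
  constructor
  · rintro ⟨e⟩
    exact LieTilde.exists_sq_eq_smul hx e
  · rintro ⟨c, hc⟩
    refine ⟨(LieEquiv.ofBijective LieTilde.semidirectToLTilde ⟨?_, ?_⟩).symm⟩
    · intro p q h
      have h1 := congrArg LieAlgebra.SemiDirectSum.left h
      have h2 := congrArg LieAlgebra.SemiDirectSum.right h
      exact LieAlgebra.SemiDirectSum.ext (LieTilde.toITilde_injective h1)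
        (LieTilde.quotToKTilde_injective h2)
    · rintro ⟨i, k⟩
      obtain ⟨m, rfl⟩ := LieTilde.toITilde_surjective i
      obtain ⟨z, rfl⟩ := LieTilde.quotToKTilde_surjective hx hc k
      exact ⟨⟨m, z⟩, rfl⟩
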